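/- Let $\mathbf c=(c_k)_{k\ge 0}$ be the Cantor sequence: $c_k=1$ if the ternary expansion of $k$ contains no digit $1$, and $c_k=0$ otherwise (equivalently $c_0=1$, $c_{3k}=c_{3k+2}=c_k$, $c_{3k+1}=0$). Put $d_k=c_k+c_{k+2}$. For $n\ge 1$ and $p\ge 0$ let $|\Gamma_n^p|=\det(c_{p+i+j})_{0\le i,j<n}$ and $|\Delta_n^p|=\det(d_{p+i+j})_{0\le i,j<n}$ be the Hankel determinants of $\mathbf c$ and $\mathbf d$; for $n=0$ use the conventions $|\Gamma_0^0|=2$, $|\Gamma_0^p|=1$ for $p\ge 1$, and $|\Delta_0^p|=1$ for $p\ge 0$. A two-dimensional sequence $(s_{m,n})_{m,n\ge 0}$ is called $3$-automatic if there are a finite alphabet $A$, a map $\psi$ assigning to each letter of $A$ a $3\times 3$ matrix over $A$, a two-dimensional sequence $(u_{m,n})_{m,n\ge 0}$ over $A$ that is a fixed point of $\psi$, i.e. $u_{3m+i,\,3n+j}=\psi(u_{m,n})_{i,j}$ for all $m,n\ge 0$ and $0\le i,j\le 2$, and a map $\tau$ on $A$ such that $s_{m,n}=\tau(u_{m,n})$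 for all $m,n\ge 0$. **Theorem.** The two-dimensional sequences $(|\Gamma_n^p| \bmod 3)_{n,p\ge 0}$ and $(|\Delta_n^p| \bmod 3)_{n,p\ge 0}$ are both $3$-automatic. -/

import Mathlib

namespace CantorHankel

/-- The Cantor sequence: `c n = 1` if the ternary expansion of `n` has no digit `1`,
and `c n = 0` otherwise. -/
def c (n : ℕ) : ℤ := if 1 ∈ Nat.digits 3 n then 0 else 1

theorem c_zero : c 0 = 1 := by simp [c]

theorem c_three_mul (n : ℕ) : c (3 * n) = c n := by
  rcases Nat.eq_zero_or_pos n with rfl | h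
  · rfl
  · unfold c
    rw [Nat.digits_def' (by norm_num) (by omega)]
    simp

theorem c_three_mul_add_one (n : ℕ) : c (3 * n + 1) = 0 := by
  unfold c
  rw [Nat.digits_def' (by norm_num) (by omega), show (3 * n + 1) % 3 = 1 by omega]
  simp

theorem c_three_mul_add_two (n : ℕ) : c (3 * n + 2) = c n := by
  unfold c
  rw [Nat.digits_def' (by norm_num) (by omega), show (3 * n + 2) % 3 = 2 by omega,
    show (3 * n + 2) / 3 = n by omega]
  simp

/-- The difference sequence `d n = c n + c (n + 2)`. -/
def d (n : ℕ) : ℤ := c n + c (n + 2)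

/-- The `(p, n)`-order Hankel matrix of the sequence `u`: the `n × n` matrix
`(u (p + i + j))` with `0 ≤ i, j < n`. -/
def hankel (u : ℕ → ℤ) (p n : ℕ) : Matrix (Fin n) (Fin n) ℤ :=
  Matrix.of fun i j => u (p + i + j)

/-- The double sequence `|Γ_n^p|`: for `n ≥ 1` the Hankel determinant of the Cantor sequence.
There is no Hankel matrix of order `n = 0`; the row `n = 0` is given by the convention
`|Γ_0^0| = 2` and `|Γ_0^p| = 1` for `p ≥ 1`. -/
def gammaDet (n p : ℕ) : ℤ :=
  if n = 0 then (if p = 0 then 2 else 1) else (hankel c p n).det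

/-- The double sequence `|Δ_n^p|`: for `n ≥ 1` the Hankel determinant of the difference
sequence `d`, and `|Δ_0^p| = 1` by convention. -/
def deltaDet (n p : ℕ) : ℤ :=
  if n = 0 then 1 else (hankel d p n).det

/-- A two-dimensional sequence `u` is a fixed point of the `[k, l]`-uniform matrix-valued
morphism `ψ`: replacing every letter `u m n` by the `k × l` block `ψ (u m n)` gives back `u`. -/
def IsFixedPoint {A : Type*} (k l : ℕ) (ψ : A → Matrix (Fin k) (Fin l) A)
    (u : ℕ → ℕ → A) : Prop :=
  ∀ (m n : ℕ) (i : Fin k) (j : Fin l), u (k * m + i) (l * n + j) = ψ (u m n) i j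

/-- `[k, l]`-automatic two-dimensional sequences (`k, l ≥ 2`): images under a coding (a map of
letters) of a fixed point of a `[k, l]`-uniform morphism over a finite alphabet. -/
def IsAutomatic₂ {B : Type*} (k l : ℕ) (s : ℕ → ℕ → B) : Prop :=
  2 ≤ k ∧ 2 ≤ l ∧
    ∃ (A : Type) (_ : Finite A) (ψ : A → Matrix (Fin k) (Fin l) A) (u : ℕ → ℕ → A) (τ : A → B),
      IsFixedPoint k l ψ u ∧ ∀ m n : ℕ, s m n = τ (u m n)

/-- A two-dimensional sequence is `k`-automatic if it is `[k, k]`-automatic. -/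
def IsKAutomatic {B : Type*} (k : ℕ) (s : ℕ → ℕ → B) : Prop := IsAutomatic₂ k k s

end CantorHankel

/-! Since `c` and `d` vanish at odd places, separating even from odd indices expresses their Hankel
determinants modulo 3 through those of `c (2 * k)` and `d (2 * k)`. These are the moments of one
functional on polynomials over the field with three elements, with weight `1` for `c` and `X + 1`
for `d`; both cases are `weightDet l` with `l = 0, 1`.

The ternary recursion of `c` says that `moment` adds the first two sections of a polynomial modulo 3
and drops the third. A Hankel determinant of order `N` is the Gram determinant of the polynomials of
degree less than `N`; modulo 3 it is the same for every basis, because a nonzero square is `1`. In a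
basis of the shape `X ^ (3 * i) * v a` with suitable `v`, the three blocks are orthogonal, and each
is up to sign a `weightDet` with `l < 2` and about a third of the order (`weightDet_eq_prod`); in
two cases an isotropic block forces the value zero (`weightDet_eq_zero`).

The resulting eighteen recurrences express `weightDet l (3n + r) (3m + s)` by the values at `n, n +
1` and `m, m + 1` and the parity of `n`. Hence a finite window of values, together with parities,
determines the windows at all 3 × 3 descendants, and such a finite state yields an automatic
sequence. -/

namespace CantorHankel
open Polynomial

/-! ### Determinants -/

/-- A matrix whose rows indexed by `α` are supported on fewer than `|α|` columns is singular. -/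
theorem det_eq_zero_of_rows_supported {R ι α β : Type*} [CommRing R] [Fintype ι] [DecidableEq ι]
    [Fintype α] [Fintype β] (M : Matrix ι ι R) (g : α → ι) (hg : Function.Injective g)
    (h : β → ι) (hcard : Fintype.card β < Fintype.card α)
    (hM : ∀ a j, j ∉ Set.range h → M (g a) j = 0) : M.det = 0 := by
  -- After transposing, `σ` sends rows to columns in the Leibniz sum; by the pigeonhole principle
  -- each term contains a zero factor.
  rw [← Matrix.det_transpose, Matrix.det_apply]
  refine Finset.sum_eq_zero fun σ _ => ?_
  have : ∃ a, σ (g a) ∉ Set.range h := by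
    by_contra! hall
    choose t ht using hall
    have hinj : Function.Injective t := fun a a' haa => by
      have := ht a
      rw [haa, ht a'] at this
      exact (hg (σ.injective this)).symm
    exact absurd (Fintype.card_le_of_injective t hinj) (by omega)
  obtain ⟨a, ha⟩ := this
  rw [Finset.prod_eq_zero (Finset.mem_univ (g a)) (by simpa using hM a _ ha), smul_zero]

/-- The determinant of an anti-diagonal block matrix with two equal square blocks. -/
theorem det_fromBlocks_zero_self {R : Type*} [CommRing R] {n : ℕ} (B : Matrix (Fin n) (Fin n) R) :
    (Matrix.fromBlocks 0 B B 0).det = (-1) ^ n * B.det ^ 2 := by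
  -- Block row and column operations make the matrix triangular with diagonal blocks `-B` and `B`,
  -- so the sign comes from `det (-B)`.
  have h : Matrix.fromBlocks 0 B B 0 = Matrix.fromBlocks 1 1 0 1 *
      (Matrix.fromBlocks (-B) 0 B B * Matrix.fromBlocks 1 (-1) 0 1) := by
    simp [Matrix.fromBlocks_multiply]
  rw [h, Matrix.det_mul, Matrix.det_mul, Matrix.det_fromBlocks_zero₂₁,
    Matrix.det_fromBlocks_zero₁₂, Matrix.det_fromBlocks_zero₂₁, Matrix.det_neg]
  simp
  ring

theorem gram_eq_mul_gram_mul {ι κ : Type*} [Fintype κ] (B : (ZMod 3)[X] →ₗ[ZMod 3] ZMod 3)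
    (f : ι → (ZMod 3)[X]) (u : κ → (ZMod 3)[X]) (P : Matrix ι κ (ZMod 3))
    (h : ∀ i, f i = ∑ k, P i k • u k) :
    (Matrix.of fun i j => B (f i * f j)) =
      P * (Matrix.of fun i j => B (u i * u j)) * P.transpose := by
  ext i j
  rw [Matrix.of_apply, h i, h j, Finset.sum_mul_sum, Finset.sum_comm]
  simp only [map_sum, Matrix.mul_apply, Matrix.transpose_apply, Finset.sum_mul,
    Matrix.of_apply, smul_mul_smul_comm, map_smul, smul_eq_mul]
  exact Finset.sum_congr rfl fun _ _ => Finset.sum_congr rfl fun _ _ => by ring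

/-- Over the field with three elements, the Gram determinant of the form `(f, g) ↦ B (f * g)` on
the polynomials of degree less than `N` does not depend on the basis. -/
theorem det_gram_eq {ι : Type*} [Fintype ι] [DecidableEq ι] {N : ℕ} (hι : Fintype.card ι = N)
    (B : (ZMod 3)[X] →ₗ[ZMod 3] ZMod 3) (f : ι → (ZMod 3)[X]) (hdeg : ∀ i, (f i).natDegree < N)
    (hspan : ∀ j < N, (X : (ZMod 3)[X]) ^ j ∈ Submodule.span (ZMod 3) (Set.range f)) :
    (Matrix.of fun i j => B (f i * f j)).det =
      (Matrix.of fun i j : Fin N => B (X ^ (i : ℕ) * X ^ (j : ℕ))).det := by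
  let e : Fin N ≃ ι := (Fintype.equivFinOfCardEq hι).symm
  have hQ : ∀ j : Fin N, ∃ q : Fin N → ZMod 3, ∑ i, q i • f (e i) = X ^ (j : ℕ) := fun j => by
    have := hspan j j.2
    rw [← e.surjective.range_comp f] at this
    exact (Submodule.mem_span_range_iff_exists_fun _).1 this
  choose q hq using hQ
  let P : Matrix (Fin N) (Fin N) (ZMod 3) := Matrix.of fun i j => (f (e i)).coeff j
  have h1 := gram_eq_mul_gram_mul B (f ∘ e) (fun j : Fin N => X ^ (j : ℕ)) P fun i => by
      simp only [Function.comp_apply, P, Matrix.of_apply, smul_eq_C_mul]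
      conv_lhs => rw [(f (e i)).as_sum_range_C_mul_X_pow' (hdeg (e i)), Finset.sum_range]
  have h2 := gram_eq_mul_gram_mul B (fun j : Fin N => X ^ (j : ℕ)) (f ∘ e) (Matrix.of q)
    fun j => (hq j).symm
  -- The two base changes need not be shown inverse to each other: if `p = 0`, then `x` and `h` both
  -- vanish, and otherwise `p ^ 2 = 1`.
  have key : ∀ x h p s : ZMod 3, x = p * h * p → h = s * x * s → x = h := by decide
  rw [← Matrix.det_submatrix_equiv_self e]
  refine key _ _ P.det (Matrix.of q).det ((congrArg Matrix.det h1).trans ?_)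
    ((congrArg Matrix.det h2).trans ?_)
  · rw [Matrix.det_mul, Matrix.det_mul, Matrix.det_transpose]
  · rw [Matrix.det_mul, Matrix.det_mul, Matrix.det_transpose]
    rfl

/-! ### The Cantor sequence at even places -/

/-- A number with only the ternary digits 0 and 2 is even. -/
theorem c_two_mul_add_one (k : ℕ) : c (2 * k + 1) = 0 := by
  induction k using Nat.strong_induction_on with
  | _ k ih =>
    obtain ⟨q, hq | hq | hq⟩ : ∃ q, k = 3 * q ∨ k = 3 * q + 1 ∨ k = 3 * q + 2 :=
      ⟨k / 3, by omega⟩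
    · rw [show 2 * k + 1 = 3 * (2 * q) + 1 by omega, c_three_mul_add_one]
    · rw [show 2 * k + 1 = 3 * (2 * q + 1) by omega, c_three_mul, ih q (by omega)]
    · rw [show 2 * k + 1 = 3 * (2 * q + 1) + 2 by omega, c_three_mul_add_two, ih q (by omega)]

/-- The linear functional on polynomials with moments `c 0, c 2, c 4, …` modulo `3`. -/
noncomputable def moment : (ZMod 3)[X] →ₗ[ZMod 3] ZMod 3 :=
  (basisMonomials (ZMod 3)).constr (ZMod 3) fun k => (c (2 * k) : ZMod 3)

theorem moment_monomial (k : ℕ) (a : ZMod 3) :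
    moment (monomial k a) = a * (c (2 * k) : ZMod 3) := by
  rw [← mul_one a, ← smul_eq_mul a 1, ← smul_monomial, map_smul, moment]
  exact congrArg (a • ·) ((basisMonomials (ZMod 3)).constr_basis _ _ k) |>.trans (by simp)

theorem moment_X_pow (k : ℕ) : moment (X ^ k) = (c (2 * k) : ZMod 3) := by
  rw [← monomial_one_right_eq_X_pow, moment_monomial, one_mul]

/-- This and the next two lemmas are the ternary recursion of `k ↦ c (2 * k)`: doubling turns the
last digits 0, 1, 2 of `k` into 0, 2, 1, so the digit that kills the moment is now 2. -/
theorem moment_expand (f : (ZMod 3)[X]) : moment (expand (ZMod 3) 3 f) = moment f := by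
  induction f using Polynomial.induction_on' with
  | add p q hp hq => simp [hp, hq]
  | monomial n a =>
    rw [expand_monomial, moment_monomial, moment_monomial,
      show 2 * (n * 3) = 3 * (2 * n) by ring, c_three_mul]

theorem moment_X_mul_expand (f : (ZMod 3)[X]) :
    moment (X * expand (ZMod 3) 3 f) = moment f := by
  induction f using Polynomial.induction_on' with
  | add p q hp hq => simp [mul_add, hp, hq]
  | monomial n a =>
    rw [expand_monomial, X_mul_monomial, moment_monomial, moment_monomial,
      show 2 * (n * 3 + 1) = 3 * (2 * n) + 2 by ring, c_three_mul_add_two]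

theorem moment_X_sq_mul_expand (f : (ZMod 3)[X]) :
    moment (X ^ 2 * expand (ZMod 3) 3 f) = 0 := by
  induction f using Polynomial.induction_on' with
  | add p q hp hq => simp [mul_add, hp, hq]
  | monomial n a =>
    rw [expand_monomial, X_pow_mul_monomial, moment_monomial,
      show 2 * (n * 3 + 2) = 3 * (2 * n + 1) + 1 by ring, c_three_mul_add_one]
    simp

/-- `g` is a polynomial with `moment (f * h (X ^ 3)) = moment (g * h)` for all `h`, for the reason
that it is the sum of the first two of the three sections of `f` modulo `3`. -/
def IsReduction (f g : (ZMod 3)[X]) : Prop :=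
  ∃ h₀ h₁ h₂ : (ZMod 3)[X], f = expand (ZMod 3) 3 h₀ + X * expand (ZMod 3) 3 h₁ +
    X ^ 2 * expand (ZMod 3) 3 h₂ ∧ g = h₀ + h₁

theorem IsReduction.moment_eq {f g : (ZMod 3)[X]} (h : IsReduction f g) (p : (ZMod 3)[X]) :
    moment (f * expand (ZMod 3) 3 p) = moment (g * p) := by
  obtain ⟨h₀, h₁, h₂, rfl, rfl⟩ := h
  rw [show (expand (ZMod 3) 3 h₀ + X * expand (ZMod 3) 3 h₁ + X ^ 2 * expand (ZMod 3) 3 h₂) *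
    expand (ZMod 3) 3 p = expand (ZMod 3) 3 (h₀ * p) + X * expand (ZMod 3) 3 (h₁ * p) +
      X ^ 2 * expand (ZMod 3) 3 (h₂ * p) by simp only [map_mul]; ring, map_add, map_add,
    moment_expand, moment_X_mul_expand, moment_X_sq_mul_expand, add_mul, map_add, add_zero]

/-- The Hankel determinants of the functional with density `X ^ m * (X + 1) ^ l`
with respect to `moment`. -/
noncomputable def weightDet (l n m : ℕ) : ZMod 3 :=
  (Matrix.of fun i j : Fin n => moment (X ^ m * (X + 1) ^ l * X ^ (i + j : ℕ))).det

theorem weightDet_eq (l n m : ℕ) : weightDet l n m = (Matrix.of fun i j : Fin n =>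
    (moment ∘ₗ LinearMap.mulLeft (ZMod 3) (X ^ m * (X + 1) ^ l))
      (X ^ (i : ℕ) * X ^ (j : ℕ))).det := by
  simp only [weightDet, LinearMap.comp_apply, LinearMap.mulLeft_apply, pow_add]

/-- The polynomials `X ^ (3 * i) * v a`, `i < ν a`, form a basis of the polynomials of degree
less than `N`. -/
structure IsSectionBasis (N : ℕ) (ν : Fin 3 → ℕ) (v : Fin 3 → (ZMod 3)[X]) : Prop where
  sum_eq : ∑ a, ν a = N
  lt_of_lt : ∀ k (a : Fin 3), 3 * k + a < N → k < ν a
  -- Equivalent to `deg (v a) + 3 * (ν a - 1) ≤ N - 1` without subtraction: the last element of each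
  -- block still has degree less than `N`.
  natDegree_le : ∀ a, (v a).natDegree + 3 * ν a ≤ N + 2
  -- The degree bound ensures that after multiplication by `X ^ (3 * k)`, `k < ν t`, only basis
  -- elements with index below `ν a` occur.
  span : ∀ t : Fin 3, ∃ q : Fin 3 → (ZMod 3)[X],
    X ^ (t : ℕ) = ∑ a, expand (ZMod 3) 3 (q a) * v a ∧
      ∀ a, q a = 0 ∨ (q a).natDegree + ν t ≤ ν a

/-- Here `ν a` counts the exponents below `N` congruent to `a` modulo 3, `δ a` bounds the degree of
`v a`, and row `t` of `q` holds the coordinates of `X ^ t` with respect to `v`. -/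
theorem IsSectionBasis.of_matrix {N : ℕ} {ν δ : Fin 3 → ℕ} {v : Fin 3 → (ZMod 3)[X]}
    (hν : ∀ a, ν a = (N + 2 - a) / 3) (hδ : ∀ a, δ a + 3 * ν a ≤ N + 2)
    (q : Matrix (Fin 3) (Fin 3) (ZMod 3)[X])
    (hq' : ∀ t a, q t a = 0 ∨ (q t a).natDegree + ν t ≤ ν a)
    (h0 : (v 0).natDegree ≤ δ 0) (h1 : (v 1).natDegree ≤ δ 1) (h2 : (v 2).natDegree ≤ δ 2)
    (hq : ∀ t : Fin 3, X ^ (t : ℕ) = ∑ a, expand (ZMod 3) 3 (q t a) * v a) :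
    IsSectionBasis N ν v where
  sum_eq := by
    rw [Fin.sum_univ_three, hν, hν, hν]
    simp only [Fin.val_zero, Fin.val_one, Fin.val_two]
    omega
  lt_of_lt k a h := by
    rw [hν]
    omega
  natDegree_le a := by
    have := hδ a
    fin_cases a
    · exact (Nat.add_le_add_right h0 _).trans this
    · exact (Nat.add_le_add_right h1 _).trans this
    · exact (Nat.add_le_add_right h2 _).trans this
  span t := ⟨q t, hq t, hq' t⟩

theorem IsSectionBasis.three_mul {n : ℕ} {v : Fin 3 → (ZMod 3)[X]}
    (q : Matrix (Fin 3) (Fin 3) (ZMod 3)[X])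
    (hq' : ∀ t a, q t a = 0 ∨ (q t a).natDegree + ![n, n, n] t ≤ ![n, n, n] a)
    (h0 : (v 0).natDegree ≤ 2) (h1 : (v 1).natDegree ≤ 2) (h2 : (v 2).natDegree ≤ 2)
    (hq : ∀ t : Fin 3, X ^ (t : ℕ) = ∑ a, expand (ZMod 3) 3 (q t a) * v a) :
    IsSectionBasis (3 * n) ![n, n, n] v :=
  .of_matrix (δ := ![2, 2, 2]) (by simp [Fin.forall_fin_succ]; omega)
    (by simp [Fin.forall_fin_succ]; omega) q hq' h0 h1 h2 hq

theorem IsSectionBasis.three_mul_add_one {n : ℕ} {v : Fin 3 → (ZMod 3)[X]}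
    (q : Matrix (Fin 3) (Fin 3) (ZMod 3)[X])
    (hq' : ∀ t a, q t a = 0 ∨ (q t a).natDegree + ![n + 1, n, n] t ≤ ![n + 1, n, n] a)
    (h0 : (v 0).natDegree ≤ 0) (h1 : (v 1).natDegree ≤ 3) (h2 : (v 2).natDegree ≤ 3)
    (hq : ∀ t : Fin 3, X ^ (t : ℕ) = ∑ a, expand (ZMod 3) 3 (q t a) * v a) :
    IsSectionBasis (3 * n + 1) ![n + 1, n, n] v :=
  .of_matrix (δ := ![0, 3, 3]) (by simp [Fin.forall_fin_succ]; omega)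
    (by simp [Fin.forall_fin_succ]; omega) q hq' h0 h1 h2 hq

theorem IsSectionBasis.three_mul_add_two {n : ℕ} {v : Fin 3 → (ZMod 3)[X]}
    (q : Matrix (Fin 3) (Fin 3) (ZMod 3)[X])
    (hq' : ∀ t a, q t a = 0 ∨ (q t a).natDegree + ![n + 1, n + 1, n] t ≤ ![n + 1, n + 1, n] a)
    (h0 : (v 0).natDegree ≤ 1) (h1 : (v 1).natDegree ≤ 1) (h2 : (v 2).natDegree ≤ 4)
    (hq : ∀ t : Fin 3, X ^ (t : ℕ) = ∑ a, expand (ZMod 3) 3 (q t a) * v a) :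
    IsSectionBasis (3 * n + 2) ![n + 1, n + 1, n] v :=
  .of_matrix (δ := ![1, 1, 4]) (by simp [Fin.forall_fin_succ]; omega)
    (by simp [Fin.forall_fin_succ]; omega) q hq' h0 h1 h2 hq

/-! ### Orthogonal decomposition of the Gram matrix. -/

section Decomposition

variable {ν : Fin 3 → ℕ} {N l s : ℕ} {v : Fin 3 → (ZMod 3)[X]}

/-- The Hankel determinant of order `N` as the Gram determinant of the basis
`X ^ (3 * i) * v a`, `i < ν a`, of the polynomials of degree less than `N`. -/
theorem weightDet_eq_det_sigma (M : ℕ) (hv : IsSectionBasis N ν v) :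
    weightDet l N (3 * M + s) = (Matrix.of fun x y : Σ a, Fin (ν a) =>
      moment (X ^ s * (X + 1) ^ l * (v x.1 * v y.1) *
        expand (ZMod 3) 3 (X ^ M * X ^ (x.2 + y.2 : ℕ)))).det := by
  rw [weightDet_eq, ← det_gram_eq (by simpa using hv.sum_eq) _
    (fun x : Σ a, Fin (ν a) => expand (ZMod 3) 3 (X ^ (x.2 : ℕ)) * v x.1)]
  · refine congrArg Matrix.det (Matrix.ext fun x y => ?_)
    rw [Matrix.of_apply, Matrix.of_apply, LinearMap.comp_apply, LinearMap.mulLeft_apply]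
    refine congrArg moment ?_
    simp only [map_mul, map_pow, expand_X]
    ring
  · rintro ⟨a, i⟩
    have h1 := natDegree_mul_le (p := expand (ZMod 3) 3 (X ^ (i : ℕ))) (q := v a)
    have h2 := hv.natDegree_le a
    rw [natDegree_expand, natDegree_X_pow] at h1
    have := i.2
    dsimp only
    omega
  · intro j hj
    set S := Submodule.span (ZMod 3)
      (Set.range fun x : Σ a, Fin (ν a) => expand (ZMod 3) 3 (X ^ (x.2 : ℕ)) * v x.1) with hS
    have hmem : ∀ a (p : (ZMod 3)[X]), p.natDegree < ν a → expand (ZMod 3) 3 p * v a ∈ S := by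
      intro a p hp
      rw [p.as_sum_range_C_mul_X_pow' hp, map_sum, Finset.sum_mul]
      refine Submodule.sum_mem _ fun i hi => ?_
      rw [map_mul, expand_C, mul_assoc, ← smul_eq_C_mul]
      exact Submodule.smul_mem _ _ (Submodule.subset_span ⟨⟨a, ⟨i, Finset.mem_range.1 hi⟩⟩, rfl⟩)
    -- With `j = 3k + t`, expand `X ^ t` in the `v a`; the coefficient `X ^ k * q a` has degree
    -- below `ν t + (ν a - ν t) = ν a` unless it is zero.
    obtain ⟨q, hq, hq'⟩ := hv.span ⟨j % 3, Nat.mod_lt _ (by norm_num)⟩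
    have hk := hv.lt_of_lt (j / 3) ⟨j % 3, Nat.mod_lt _ (by norm_num)⟩ (by simp only; omega)
    have hj' : (X : (ZMod 3)[X]) ^ j = expand (ZMod 3) 3 (X ^ (j / 3)) * X ^ (j % 3) := by
      rw [map_pow, expand_X, ← pow_mul, ← pow_add, Nat.div_add_mod]
    rw [hj']
    dsimp only at hq
    rw [hq, Finset.mul_sum]
    refine Submodule.sum_mem _ fun a _ => ?_
    rw [← mul_assoc, ← map_mul]
    rcases hq' a with h0 | h0
    · simp [h0]
    · refine hmem a _ (natDegree_mul_le.trans_lt ?_)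
      rw [natDegree_X_pow]
      omega

/-- If the subspaces belonging to `v 0, v 1, v 2` are orthogonal to each other, the Hankel
determinant splits. -/
theorem weightDet_eq_prod (M : ℕ) (hv : IsSectionBasis N ν v) (d : Fin 3 → ZMod 3)
    (e l' : Fin 3 → ℕ)
    (h01 : IsReduction (X ^ s * (X + 1) ^ l * (v 0 * v 1)) 0)
    (h02 : IsReduction (X ^ s * (X + 1) ^ l * (v 0 * v 2)) 0)
    (h12 : IsReduction (X ^ s * (X + 1) ^ l * (v 1 * v 2)) 0)
    (h00 : IsReduction (X ^ s * (X + 1) ^ l * (v 0 * v 0))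
      (C (d 0) * X ^ e 0 * (X + 1) ^ l' 0))
    (h11 : IsReduction (X ^ s * (X + 1) ^ l * (v 1 * v 1))
      (C (d 1) * X ^ e 1 * (X + 1) ^ l' 1))
    (h22 : IsReduction (X ^ s * (X + 1) ^ l * (v 2 * v 2))
      (C (d 2) * X ^ e 2 * (X + 1) ^ l' 2)) :
    weightDet l N (3 * M + s) = ∏ a, d a ^ ν a * weightDet (l' a) (ν a) (M + e a) := by
  have hoff : ∀ a b, a < b → IsReduction (X ^ s * (X + 1) ^ l * (v a * v b)) 0 := by
    intro a b hab
    fin_cases a <;> fin_cases b <;> first | exact h01 | exact h02 | exact h12 | simp at hab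
  have hdiag : ∀ a, IsReduction (X ^ s * (X + 1) ^ l * (v a * v a))
      (C (d a) * X ^ e a * (X + 1) ^ l' a) := by
    intro a
    fin_cases a <;> assumption
  rw [weightDet_eq_det_sigma M hv,
    Matrix.BlockTriangular.det_fintype (b := Sigma.fst)]
  · refine Finset.prod_congr rfl fun a _ => ?_
    have hsmul := Matrix.det_smul (Matrix.of fun i j : Fin (ν a) =>
      moment (X ^ (M + e a) * (X + 1) ^ l' a * X ^ (i + j : ℕ))) (d a)
    rw [Fintype.card_fin] at hsmul
    rw [weightDet, ← hsmul, ← Matrix.det_submatrix_equiv_self (Equiv.sigmaSubtype a).symm]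
    congr 1
    ext i j
    simp only [Matrix.submatrix_apply, Matrix.toSquareBlock_def, Matrix.of_apply,
      Matrix.smul_apply]
    have := (hdiag a).moment_eq (X ^ M * X ^ (i + j : ℕ))
    refine this.trans ?_
    rw [← map_smul, smul_eq_C_mul]
    refine congrArg moment ?_
    ring
  · rintro ⟨b, j⟩ ⟨a, i⟩ hab
    rw [Matrix.of_apply, mul_comm (v _), (hoff a b hab).moment_eq, zero_mul, map_zero]

/-- Block `0` is orthogonal to itself and to every other block except `b`, so its `ν 0` rows live on
only `ν b < ν 0` columns. -/
theorem weightDet_eq_zero (M : ℕ) (hv : IsSectionBasis N ν v)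
    (b : Fin 3) (hb : ν b < ν 0)
    (horth : ∀ a, a ≠ b → IsReduction (X ^ s * (X + 1) ^ l * (v 0 * v a)) 0) :
    weightDet l N (3 * M + s) = 0 := by
  rw [weightDet_eq_det_sigma M hv]
  refine det_eq_zero_of_rows_supported _ (fun i : Fin (ν 0) => ⟨0, i⟩)
    (fun i j h => by simpa using h)
    (fun i : Fin (ν b) => ⟨b, i⟩) (by simpa using hb) ?_
  rintro i ⟨a, j⟩ hj
  have hab : a ≠ b := by
    rintro rfl
    exact hj ⟨j, rfl⟩
  rw [Matrix.of_apply, (horth a hab).moment_eq, zero_mul, map_zero]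

end Decomposition

/-! ### Recurrences for `weightDet` modulo three -/

/-- The pattern of all the product recurrences: the triples are the three sections of `X ^ s * (X +
1) ^ l * v a * v b` for the pairs 01, 02, 12, 00, 11, 22. The first two sections cancel off the
diagonal, and on it they add up to `±X ^ e * (X + 1) ^ l'` with `l' < 2`. Typical here is `1 - X + X
^ 2 = (1 + X) ^ 2` with `(1 + X) ^ 3 = 1 + X ^ 3`. -/
theorem weightDet_zero_three_mul_three_mul (n m : ℕ) :
    weightDet 0 (3 * n) (3 * m) =
      weightDet 0 n (m + 1) * weightDet 0 n m * ((-1) ^ n * weightDet 1 n m) := by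
  have hv : IsSectionBasis (3 * n) ![n, n, n]
      ![X ^ 2, 1, 1 - X + X ^ 2] := by
    refine .three_mul !![0, 1, 0; 1, 1, -1; 1, 0, 0] ?_ ?_ ?_ ?_ ?_
    · simp [Fin.forall_fin_succ, add_comm]
    iterate 3 · (try simp) <;> (try compute_degree!)
    · simp [Fin.forall_fin_succ, Fin.sum_univ_three]; grind
  refine (weightDet_eq_prod (s := 0) m hv ![1, 1, -1]
    ![1, 0, 0] ![0, 0, 1]
    ⟨0, 0, 1, ?_, ?_⟩ ⟨-X, X, 1, ?_, ?_⟩ ⟨1, -1, 1, ?_, ?_⟩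
    ⟨0, X, 0, ?_, ?_⟩ ⟨1, 0, 0, ?_, ?_⟩ ⟨1 + X, 1 + X, 0, ?_, ?_⟩).trans
    (by simp [Fin.prod_univ_three])
  all_goals simp <;> grind

theorem weightDet_zero_three_mul_add_one_three_mul (n m : ℕ) :
    weightDet 0 (3 * n + 1) (3 * m) =
      weightDet 0 (n + 1) m * weightDet 0 n (m + 1) * ((-1) ^ n * weightDet 1 n m) := by
  have hv : IsSectionBasis (3 * n + 1) ![n + 1, n, n]
      ![1, X ^ 2, 1 - X + X ^ 2] := by
    refine .three_mul_add_one !![1, 0, 0; 1, 1, -1; 0, 1, 0] ?_ ?_ ?_ ?_ ?_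
    · simp [Fin.forall_fin_succ, add_comm]
    iterate 3 · (try simp) <;> (try compute_degree!)
    · simp [Fin.forall_fin_succ, Fin.sum_univ_three]
  refine (weightDet_eq_prod (s := 0) m hv ![1, 1, -1]
    ![0, 1, 0] ![0, 0, 1]
    ⟨0, 0, 1, ?_, ?_⟩ ⟨1, -1, 1, ?_, ?_⟩ ⟨-X, X, 1, ?_, ?_⟩
    ⟨1, 0, 0, ?_, ?_⟩ ⟨0, X, 0, ?_, ?_⟩ ⟨1 + X, 1 + X, 0, ?_, ?_⟩).trans
    (by simp [Fin.prod_univ_three])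
  all_goals simp <;> grind

theorem weightDet_zero_three_mul_add_two_three_mul (n m : ℕ) :
    weightDet 0 (3 * n + 2) (3 * m) =
      weightDet 0 (n + 1) m * ((-1) ^ (n + 1) * weightDet 0 (n + 1) m) * weightDet 1 n (m + 1) := by
  have hv : IsSectionBasis (3 * n + 2) ![n + 1, n + 1, n]
      ![1, -1 + X, X ^ 2 - X ^ 3 + X ^ 4] := by
    refine .three_mul_add_two !![1, 0, 0; 1, 1, 0; 0, -X, 1] ?_ ?_ ?_ ?_ ?_
    · simp [Fin.forall_fin_succ, add_comm]
    iterate 3 · (try simp) <;> (try compute_degree!)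
    · simp [Fin.forall_fin_succ, Fin.sum_univ_three]; grind
  refine (weightDet_eq_prod (s := 0) m hv ![1, -1, 1]
    ![0, 0, 1] ![0, 0, 1]
    ⟨-1, 1, 0, ?_, ?_⟩ ⟨-X, X, 1, ?_, ?_⟩ ⟨-X, X, -1 + X, ?_, ?_⟩
    ⟨1, 0, 0, ?_, ?_⟩ ⟨1, 1, 1, ?_, ?_⟩ ⟨0, X + X ^ 2, X + X ^ 2, ?_, ?_⟩).trans
    (by simp [Fin.prod_univ_three])
  all_goals simp <;> grind

theorem weightDet_zero_three_mul_three_mul_add_one (n m : ℕ) :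
    weightDet 0 (3 * n) (3 * m + 1) =
      weightDet 0 n (m + 1) * ((-1) ^ n * weightDet 0 n (m + 1)) * weightDet 1 n m := by
  have hv : IsSectionBasis (3 * n) ![n, n, n]
      ![X, -X + X ^ 2, 1 - X + X ^ 2] := by
    refine .three_mul !![0, -1, 1; 1, 0, 0; 1, 1, 0] ?_ ?_ ?_ ?_ ?_
    · simp [Fin.forall_fin_succ, add_comm]
    iterate 3 · (try simp) <;> (try compute_degree!)
    · simp [Fin.forall_fin_succ, Fin.sum_univ_three]; grind
  refine (weightDet_eq_prod (s := 1) m hv ![1, -1, 1]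
    ![1, 1, 0] ![0, 0, 1]
    ⟨-X, X, 0, ?_, ?_⟩ ⟨-X, X, 1, ?_, ?_⟩ ⟨-X, X, -1 + X, ?_, ?_⟩
    ⟨X, 0, 0, ?_, ?_⟩ ⟨X, X, X, ?_, ?_⟩ ⟨0, 1 + X, 1 + X, ?_, ?_⟩).trans
    (by simp [Fin.prod_univ_three])
  all_goals simp <;> grind

theorem weightDet_zero_three_mul_add_one_three_mul_add_one (n m : ℕ) :
    weightDet 0 (3 * n + 1) (3 * m + 1) =
      weightDet 0 (n + 1) m * weightDet 0 n (m + 1) * ((-1) ^ n * weightDet 1 n (m + 1)) := by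
  have hv : IsSectionBasis (3 * n + 1) ![n + 1, n, n]
      ![1, X, X - X ^ 2 + X ^ 3] := by
    refine .three_mul_add_one !![1, 0, 0; 0, 1, 0; X, 1, -1] ?_ ?_ ?_ ?_ ?_
    · simp [Fin.forall_fin_succ, add_comm]
    iterate 3 · (try simp) <;> (try compute_degree!)
    · simp [Fin.forall_fin_succ, Fin.sum_univ_three]; grind
  refine (weightDet_eq_prod (s := 1) m hv ![1, 1, -1]
    ![0, 1, 1] ![0, 0, 1]
    ⟨0, 0, 1, ?_, ?_⟩ ⟨-X, X, 1, ?_, ?_⟩ ⟨X, -X, X, ?_, ?_⟩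
    ⟨0, 1, 0, ?_, ?_⟩ ⟨X, 0, 0, ?_, ?_⟩ ⟨X + X ^ 2, X + X ^ 2, 0, ?_, ?_⟩).trans
    (by simp [Fin.prod_univ_three])
  all_goals simp <;> grind

theorem weightDet_zero_three_mul_add_two_three_mul_add_one (n m : ℕ) :
    weightDet 0 (3 * n + 2) (3 * m + 1) =
      weightDet 0 (n + 1) (m + 1) * weightDet 0 (n + 1) m * ((-1) ^ n * weightDet 1 n (m + 1)) := by
  have hv : IsSectionBasis (3 * n + 2) ![n + 1, n + 1, n]
      ![X, 1, X - X ^ 2 + X ^ 3] := by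
    refine .three_mul_add_two !![0, 1, 0; 1, 0, 0; 1, X, -1] ?_ ?_ ?_ ?_ ?_
    · simp [Fin.forall_fin_succ, add_comm]
    iterate 3 · (try simp) <;> (try compute_degree!)
    · simp [Fin.forall_fin_succ, Fin.sum_univ_three]
  refine (weightDet_eq_prod (s := 1) m hv ![1, 1, -1]
    ![1, 0, 1] ![0, 0, 1]
    ⟨0, 0, 1, ?_, ?_⟩ ⟨X, -X, X, ?_, ?_⟩ ⟨-X, X, 1, ?_, ?_⟩
    ⟨X, 0, 0, ?_, ?_⟩ ⟨0, 1, 0, ?_, ?_⟩ ⟨X + X ^ 2, X + X ^ 2, 0, ?_, ?_⟩).trans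
    (by simp [Fin.prod_univ_three])
  all_goals simp <;> grind

theorem weightDet_zero_three_mul_three_mul_add_two (n m : ℕ) :
    weightDet 0 (3 * n) (3 * m + 2) =
      weightDet 0 n (m + 1) * weightDet 1 n (m + 1) * ((-1) ^ n * weightDet 0 n (m + 1)) := by
  have hv : IsSectionBasis (3 * n) ![n, n, n]
      ![X, 1 - X + X ^ 2, -1 + X] := by
    refine .three_mul !![1, 0, -1; 1, 0, 0; 0, 1, 1] ?_ ?_ ?_ ?_ ?_
    · simp [Fin.forall_fin_succ, add_comm]
    iterate 3 · (try simp) <;> (try compute_degree!)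
    · simp [Fin.forall_fin_succ, Fin.sum_univ_three]; grind
  refine (weightDet_eq_prod (s := 2) m hv ![1, 1, -1]
    ![1, 1, 1] ![0, 1, 0]
    ⟨X, -X, X, ?_, ?_⟩ ⟨-X, X, 0, ?_, ?_⟩ ⟨-X, X, -1 + X, ?_, ?_⟩
    ⟨0, X, 0, ?_, ?_⟩ ⟨X + X ^ 2, 0, 1 + X, ?_, ?_⟩ ⟨X, X, 1, ?_, ?_⟩).trans
    (by simp [Fin.prod_univ_three])
  all_goals simp <;> grind

/-- For the weight `X ^ 2` the `n + 1` powers `X ^ (3 * i)` span an isotropic space, since only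
third sections occur; it pairs nontrivially at most with a block of dimension `n`. -/
theorem weightDet_zero_three_mul_add_one_three_mul_add_two (n m : ℕ) :
    weightDet 0 (3 * n + 1) (3 * m + 2) = 0 := by
  have hv : IsSectionBasis (3 * n + 1) ![n + 1, n, n]
      ![1, X ^ 2, -X + X ^ 2] := by
    refine .three_mul_add_one !![1, 0, 0; 0, 1, -1; 0, 1, 0] ?_ ?_ ?_ ?_ ?_
    · simp [Fin.forall_fin_succ, add_comm]
    iterate 3 · (try simp) <;> (try compute_degree!)
    · simp [Fin.forall_fin_succ, Fin.sum_univ_three]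
  refine weightDet_eq_zero (s := 2) m hv 1 (by simp) fun a ha => ?_
  obtain rfl | rfl : a = 0 ∨ a = 2 := by
    revert a
    decide
  · exact ⟨0, 0, 1, by simp, by simp⟩
  · exact ⟨-X, X, 0, by simp; grind, by simp⟩

theorem weightDet_zero_three_mul_add_two_three_mul_add_two (n m : ℕ) :
    weightDet 0 (3 * n + 2) (3 * m + 2) =
      weightDet 0 (n + 1) (m + 1) * ((-1) ^ (n + 1) * weightDet 0 (n + 1) (m + 1)) *
        weightDet 1 n (m + 1) := by
  have hv : IsSectionBasis (3 * n + 2) ![n + 1, n + 1, n]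
      ![X, -1 + X, 1 - X + X ^ 2] := by
    refine .three_mul_add_two !![1, -1, 0; 1, 0, 0; 0, 1, 1] ?_ ?_ ?_ ?_ ?_
    · simp [Fin.forall_fin_succ, add_comm]
    iterate 3 · (try simp) <;> (try compute_degree!)
    · simp [Fin.forall_fin_succ, Fin.sum_univ_three]; grind
  refine (weightDet_eq_prod (s := 2) m hv ![1, -1, 1]
    ![1, 1, 1] ![0, 0, 1]
    ⟨-X, X, 0, ?_, ?_⟩ ⟨X, -X, X, ?_, ?_⟩ ⟨-X, X, -1 + X, ?_, ?_⟩
    ⟨0, X, 0, ?_, ?_⟩ ⟨X, X, 1, ?_, ?_⟩ ⟨X + X ^ 2, 0, 1 + X, ?_, ?_⟩).trans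
    (by simp [Fin.prod_univ_three])
  all_goals simp <;> grind

theorem weightDet_one_three_mul_three_mul (n m : ℕ) :
    weightDet 1 (3 * n) (3 * m) =
      weightDet 0 n (m + 1) * weightDet 1 n m * ((-1) ^ n * weightDet 1 n m) := by
  have hv : IsSectionBasis (3 * n) ![n, n, n]
      ![X ^ 2, 1 + X, -1 + X ^ 2] := by
    refine .three_mul !![1, 0, -1; -1, 1, 1; 1, 0, 0] ?_ ?_ ?_ ?_ ?_
    · simp [Fin.forall_fin_succ, add_comm]
    iterate 3 · (try simp) <;> (try compute_degree!)
    · simp [Fin.forall_fin_succ, Fin.sum_univ_three]; grind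
  refine (weightDet_eq_prod (s := 0) m hv ![1, 1, -1]
    ![1, 0, 0] ![0, 1, 1]
    ⟨-X, X, 1, ?_, ?_⟩ ⟨-X, X, -1 + X, ?_, ?_⟩ ⟨-1 - X, 1 + X, 0, ?_, ?_⟩
    ⟨0, X, X, ?_, ?_⟩ ⟨1 + X, 0, 0, ?_, ?_⟩ ⟨1 + X, 1 + X, 1 + X, ?_, ?_⟩).trans
    (by simp [Fin.prod_univ_three])
  all_goals simp <;> grind

theorem weightDet_one_three_mul_add_one_three_mul (n m : ℕ) :
    weightDet 1 (3 * n + 1) (3 * m) =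
      ((-1) ^ (n + 1) * weightDet 0 (n + 1) m) * weightDet 1 n (m + 1) * weightDet 1 n m := by
  have hv : IsSectionBasis (3 * n + 1) ![n + 1, n, n]
      ![1, X ^ 2 + X ^ 3, 1 + X] := by
    refine .three_mul_add_one !![1, 0, 0; -1, 0, 1; -X, 1, 0] ?_ ?_ ?_ ?_ ?_
    · simp [Fin.forall_fin_succ, add_comm]
    iterate 3 · (try simp) <;> (try compute_degree!)
    · simp [Fin.forall_fin_succ, Fin.sum_univ_three]
  refine (weightDet_eq_prod (s := 0) m hv ![-1, 1, 1]
    ![0, 1, 0] ![0, 1, 1]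
    ⟨-X, X, 1, ?_, ?_⟩ ⟨1, -1, 1, ?_, ?_⟩ ⟨0, 0, 1 + X, ?_, ?_⟩
    ⟨1, 1, 0, ?_, ?_⟩ ⟨0, X + X ^ 2, 0, ?_, ?_⟩ ⟨1 + X, 0, 0, ?_, ?_⟩).trans
    (by simp [Fin.prod_univ_three])
  all_goals simp <;> grind

theorem weightDet_one_three_mul_add_two_three_mul (n m : ℕ) :
    weightDet 1 (3 * n + 2) (3 * m) =
      ((-1) ^ (n + 1) * weightDet 0 (n + 1) m) * weightDet 1 (n + 1) m * weightDet 1 n (m + 1) := by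
  have hv : IsSectionBasis (3 * n + 2) ![n + 1, n + 1, n]
      ![1, 1 + X, X ^ 2 + X ^ 3] := by
    refine .three_mul_add_two !![1, 0, 0; -1, 1, 0; -X, 0, 1] ?_ ?_ ?_ ?_ ?_
    · simp [Fin.forall_fin_succ, add_comm]
    iterate 3 · (try simp) <;> (try compute_degree!)
    · simp [Fin.forall_fin_succ, Fin.sum_univ_three]
  refine (weightDet_eq_prod (s := 0) m hv ![-1, 1, 1]
    ![0, 0, 1] ![0, 1, 1]
    ⟨1, -1, 1, ?_, ?_⟩ ⟨-X, X, 1, ?_, ?_⟩ ⟨0, 0, 1 + X, ?_, ?_⟩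
    ⟨1, 1, 0, ?_, ?_⟩ ⟨1 + X, 0, 0, ?_, ?_⟩ ⟨0, X + X ^ 2, 0, ?_, ?_⟩).trans
    (by simp [Fin.prod_univ_three])
  all_goals simp <;> grind

theorem weightDet_one_three_mul_three_mul_add_one (n m : ℕ) :
    weightDet 1 (3 * n) (3 * m + 1) =
      ((-1) ^ n * weightDet 0 n (m + 1)) * weightDet 1 n (m + 1) * weightDet 1 n m := by
  have hv : IsSectionBasis (3 * n) ![n, n, n]
      ![X, X + X ^ 2, 1 + X] := by
    refine .three_mul !![-1, 0, 1; 1, 0, 0; -1, 1, 0] ?_ ?_ ?_ ?_ ?_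
    · simp [Fin.forall_fin_succ, add_comm]
    iterate 3 · (try simp) <;> (try compute_degree!)
    · simp [Fin.forall_fin_succ, Fin.sum_univ_three]
  refine (weightDet_eq_prod (s := 1) m hv ![-1, 1, 1]
    ![1, 1, 0] ![0, 1, 1]
    ⟨X, -X, X, ?_, ?_⟩ ⟨-X, X, 1, ?_, ?_⟩ ⟨0, 0, 1 + X, ?_, ?_⟩
    ⟨X, X, 0, ?_, ?_⟩ ⟨X + X ^ 2, 0, 0, ?_, ?_⟩ ⟨0, 1 + X, 0, ?_, ?_⟩).trans
    (by simp [Fin.prod_univ_three])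
  all_goals simp <;> grind

theorem weightDet_one_three_mul_add_one_three_mul_add_one (n m : ℕ) :
    weightDet 1 (3 * n + 1) (3 * m + 1) =
      weightDet 0 (n + 1) m * weightDet 1 n (m + 1) * ((-1) ^ n * weightDet 1 n (m + 1)) := by
  have hv : IsSectionBasis (3 * n + 1) ![n + 1, n, n]
      ![1, X + X ^ 2, -X + X ^ 3] := by
    refine .three_mul_add_one !![1, 0, 0; X, 0, -1; -X, 1, 1] ?_ ?_ ?_ ?_ ?_
    · simp [Fin.forall_fin_succ, add_comm]
    iterate 3 · (try simp) <;> (try compute_degree!)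
    · simp [Fin.forall_fin_succ, Fin.sum_univ_three]; grind
  refine (weightDet_eq_prod (s := 1) m hv ![1, 1, -1]
    ![0, 1, 1] ![0, 1, 1]
    ⟨-X, X, 1, ?_, ?_⟩ ⟨-X, X, -1 + X, ?_, ?_⟩ ⟨-X - X ^ 2, X + X ^ 2, 0, ?_, ?_⟩
    ⟨0, 1, 1, ?_, ?_⟩ ⟨X + X ^ 2, 0, 0, ?_, ?_⟩ ⟨X + X ^ 2, X + X ^ 2, X + X ^ 2, ?_, ?_⟩).trans
    (by simp [Fin.prod_univ_three])
  all_goals simp <;> grind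

theorem weightDet_one_three_mul_add_two_three_mul_add_one (n m : ℕ) :
    weightDet 1 (3 * n + 2) (3 * m + 1) =
      ((-1) ^ (n + 1) * weightDet 0 (n + 1) (m + 1)) * weightDet 1 (n + 1) m *
        weightDet 1 n (m + 1) := by
  have hv : IsSectionBasis (3 * n + 2) ![n + 1, n + 1, n]
      ![X, 1 + X, X + X ^ 2] := by
    refine .three_mul_add_two !![-1, 1, 0; 1, 0, 0; -1, 0, 1] ?_ ?_ ?_ ?_ ?_
    · simp [Fin.forall_fin_succ, add_comm]
    iterate 3 · (try simp) <;> (try compute_degree!)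
    · simp [Fin.forall_fin_succ, Fin.sum_univ_three]
  refine (weightDet_eq_prod (s := 1) m hv ![-1, 1, 1]
    ![1, 0, 1] ![0, 1, 1]
    ⟨-X, X, 1, ?_, ?_⟩ ⟨X, -X, X, ?_, ?_⟩ ⟨0, 0, 1 + X, ?_, ?_⟩
    ⟨X, X, 0, ?_, ?_⟩ ⟨0, 1 + X, 0, ?_, ?_⟩ ⟨X + X ^ 2, 0, 0, ?_, ?_⟩).trans
    (by simp [Fin.prod_univ_three])
  all_goals simp <;> grind

theorem weightDet_one_three_mul_three_mul_add_two (n m : ℕ) :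
    weightDet 1 (3 * n) (3 * m + 2) =
      weightDet 1 n (m + 1) * weightDet 0 n (m + 1) * ((-1) ^ n * weightDet 1 n (m + 1)) := by
  have hv : IsSectionBasis (3 * n) ![n, n, n]
      ![X + X ^ 2, 1, -1 + X ^ 2] := by
    refine .three_mul !![0, 1, 0; 1, -1, -1; 0, 1, 1] ?_ ?_ ?_ ?_ ?_
    · simp [Fin.forall_fin_succ, add_comm]
    iterate 3 · (try simp) <;> (try compute_degree!)
    · simp [Fin.forall_fin_succ, Fin.sum_univ_three]; grind
  refine (weightDet_eq_prod (s := 2) m hv ![1, 1, -1]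
    ![1, 1, 1] ![1, 0, 1]
    ⟨X, -X, X, ?_, ?_⟩ ⟨-X - X ^ 2, X + X ^ 2, 0, ?_, ?_⟩ ⟨-X, X, -1 + X, ?_, ?_⟩
    ⟨0, X + X ^ 2, 0, ?_, ?_⟩ ⟨X, 0, 1, ?_, ?_⟩ ⟨X + X ^ 2, X + X ^ 2, 1 + X, ?_, ?_⟩).trans
    (by simp [Fin.prod_univ_three])
  all_goals simp <;> grind

theorem weightDet_one_three_mul_add_one_three_mul_add_two (n m : ℕ) :
    weightDet 1 (3 * n + 1) (3 * m + 2) =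
      weightDet 0 (n + 1) (m + 1) * weightDet 1 n (m + 1) * ((-1) ^ n * weightDet 1 n (m + 1)) := by
  have hv : IsSectionBasis (3 * n + 1) ![n + 1, n, n]
      ![1, X + X ^ 2, -1 + X ^ 2] := by
    refine .three_mul_add_one !![1, 0, 0; -1, 1, -1; 1, 0, 1] ?_ ?_ ?_ ?_ ?_
    · simp [Fin.forall_fin_succ, add_comm]
    iterate 3 · (try simp) <;> (try compute_degree!)
    · simp [Fin.forall_fin_succ, Fin.sum_univ_three]; grind
  refine (weightDet_eq_prod (s := 2) m hv ![1, 1, -1]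
    ![1, 1, 1] ![0, 1, 1]
    ⟨X, -X, X, ?_, ?_⟩ ⟨-X, X, -1 + X, ?_, ?_⟩ ⟨-X - X ^ 2, X + X ^ 2, 0, ?_, ?_⟩
    ⟨X, 0, 1, ?_, ?_⟩ ⟨0, X + X ^ 2, 0, ?_, ?_⟩ ⟨X + X ^ 2, X + X ^ 2, 1 + X, ?_, ?_⟩).trans
    (by simp [Fin.prod_univ_three])
  all_goals simp <;> grind

/-- The isotropic block is that of `1 + X`: its weighted square `X ^ 2 * (1 + X) ^ 3 = X ^ 2 * (1 +
X ^ 3)` is a pure third section. -/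
theorem weightDet_one_three_mul_add_two_three_mul_add_two (n m : ℕ) :
    weightDet 1 (3 * n + 2) (3 * m + 2) = 0 := by
  have hv : IsSectionBasis (3 * n + 2) ![n + 1, n + 1, n]
      ![1 + X, X, X ^ 2] := by
    refine .three_mul_add_two !![1, -1, 0; 0, 1, 0; 0, 0, 1] ?_ ?_ ?_ ?_ ?_
    · simp [Fin.forall_fin_succ, add_comm]
    iterate 3 · (try simp) <;> (try compute_degree!)
    · simp [Fin.forall_fin_succ, Fin.sum_univ_three]
  refine weightDet_eq_zero (s := 2) m hv 2 (by simp) fun a ha => ?_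
  obtain rfl | rfl : a = 0 ∨ a = 1 := by
    revert a
    decide
  · exact ⟨0, 0, 1 + X, by simp; grind, by simp⟩
  · exact ⟨X, -X, X, by simp; grind, by simp⟩

/-! ### Automatic sequences from finite state functions -/

/-- A sequence that depends only on a finite-valued state, such that the states of the `k × k`
descendants of a position depend only on the state of the position, is `k`-automatic. -/
theorem isKAutomatic_of_state {A : Type} [Finite A] {B : Type*} {k : ℕ} (hk : 2 ≤ k)
    {s : ℕ → ℕ → B} (u : ℕ → ℕ → A)
    (hu : ∀ m n m' n', u m n = u m' n' → ∀ i < k, ∀ j < k,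
      u (k * m + i) (k * n + j) = u (k * m' + i) (k * n' + j))
    (hs : ∀ m n m' n', u m n = u m' n' → s m n = s m' n') : IsKAutomatic k s := by
  classical
  have : Nonempty B := ⟨s 0 0⟩
  have : Nonempty A := ⟨u 0 0⟩
  -- The block of a state is read off at a chosen position having that state; states that never
  -- occur receive an arbitrary block.
  let ψ : A → Matrix (Fin k) (Fin k) A := fun a => Matrix.of fun i j =>
    if h : ∃ p : ℕ × ℕ, u p.1 p.2 = a then u (k * h.choose.1 + i) (k * h.choose.2 + j) else a
  let τ : A → B := fun a =>
    if h : ∃ p : ℕ × ℕ, u p.1 p.2 = a then s h.choose.1 h.choose.2 else s 0 0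
  refine ⟨hk, hk, A, inferInstance, ψ, u, τ, fun m n i j => ?_, fun m n => ?_⟩
  · have h : ∃ p : ℕ × ℕ, u p.1 p.2 = u m n := ⟨(m, n), rfl⟩
    simp only [ψ, Matrix.of_apply, dif_pos h]
    exact (hu _ _ _ _ h.choose_spec i i.2 j j.2).symm
  · have h : ∃ p : ℕ × ℕ, u p.1 p.2 = u m n := ⟨(m, n), rfl⟩
    simp only [τ, dif_pos h]
    exact (hs _ _ _ _ h.choose_spec).symm

/-! ### Finite states for the Hankel determinants -/

theorem neg_one_pow_eq_of_mod_two {n n' : ℕ} (h : n % 2 = n' % 2) :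
    (-1 : ZMod 3) ^ n = (-1) ^ n' := by
  rw [neg_one_pow_eq_pow_mod_two, h, ← neg_one_pow_eq_pow_mod_two]

/-- Rows divisible by 3 depend on row `n` alone. Stating this separately lets a window of two rows
determine its descendants. -/
theorem weightDet_three_mul_congr {n n' m m' : ℕ} (hn : n % 2 = n' % 2)
    (h : ∀ l < 2, ∀ y < 2, weightDet l n (m + y) = weightDet l n' (m' + y))
    {l s : ℕ} (hl : l < 2) (hs : s < 3) :
    weightDet l (3 * n) (3 * m + s) = weightDet l (3 * n') (3 * m' + s) := by
  have h00 := h 0 (by simp) 0 (by simp)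
  have h01 := h 0 (by simp) 1 (by simp)
  have h10 := h 1 (by simp) 0 (by simp)
  have h11 := h 1 (by simp) 1 (by simp)
  simp only [add_zero] at h00 h10
  have hsgn := neg_one_pow_eq_of_mod_two hn
  interval_cases l <;> interval_cases s <;> simp only [add_zero,
    weightDet_zero_three_mul_three_mul, weightDet_zero_three_mul_three_mul_add_one,
    weightDet_zero_three_mul_three_mul_add_two, weightDet_one_three_mul_three_mul,
    weightDet_one_three_mul_three_mul_add_one, weightDet_one_three_mul_three_mul_add_two,
    h00, h01, h10, h11, hsgn]

theorem weightDet_three_mul_add_congr {n n' m m' : ℕ} (hn : n % 2 = n' % 2)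
    (h : ∀ l < 2, ∀ x < 2, ∀ y < 2, weightDet l (n + x) (m + y) = weightDet l (n' + x) (m' + y))
    {l r s : ℕ} (hl : l < 2) (hr : r < 3) (hs : s < 3) :
    weightDet l (3 * n + r) (3 * m + s) = weightDet l (3 * n' + r) (3 * m' + s) := by
  rcases Nat.eq_zero_or_pos r with rfl | hr0
  · exact weightDet_three_mul_congr hn (fun l hl y hy => h l hl 0 (by simp) y hy) hl hs
  have h001 := h 0 (by simp) 0 (by simp) 1 (by simp)
  have h010 := h 0 (by simp) 1 (by simp) 0 (by simp)
  have h011 := h 0 (by simp) 1 (by simp) 1 (by simp)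
  have h100 := h 1 (by simp) 0 (by simp) 0 (by simp)
  have h101 := h 1 (by simp) 0 (by simp) 1 (by simp)
  have h110 := h 1 (by simp) 1 (by simp) 0 (by simp)
  simp only [add_zero] at h001 h010 h100 h101 h110
  have hsgn := neg_one_pow_eq_of_mod_two hn
  interval_cases r <;> interval_cases l <;> interval_cases s <;> simp only [add_zero,
    weightDet_zero_three_mul_add_one_three_mul, weightDet_zero_three_mul_add_one_three_mul_add_one,
    weightDet_zero_three_mul_add_one_three_mul_add_two, weightDet_one_three_mul_add_one_three_mul,
    weightDet_one_three_mul_add_one_three_mul_add_one,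
    weightDet_one_three_mul_add_one_three_mul_add_two,
    weightDet_zero_three_mul_add_two_three_mul, weightDet_zero_three_mul_add_two_three_mul_add_one,
    weightDet_zero_three_mul_add_two_three_mul_add_two, weightDet_one_three_mul_add_two_three_mul,
    weightDet_one_three_mul_add_two_three_mul_add_one,
    weightDet_one_three_mul_add_two_three_mul_add_two,
    h001, h010, h011, h100, h101, h110, hsgn, pow_succ]

/-- The parity of `n` and the values of both determinants in a `2 × 3` window at `(n, m)`. -/
noncomputable def window (n m : ℕ) : Fin 2 × (Fin 2 → Fin 2 → Fin 3 → ZMod 3) :=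
  (⟨n % 2, Nat.mod_lt _ two_pos⟩, fun l x y => weightDet l (n + x) (m + y))

theorem window_eq_iff {n m n' m' : ℕ} : window n m = window n' m' ↔ n % 2 = n' % 2 ∧
    ∀ l < 2, ∀ x < 2, ∀ y < 3, weightDet l (n + x) (m + y) = weightDet l (n' + x) (m' + y) := by
  simp only [window, Prod.mk.injEq, Fin.mk.injEq, funext_iff]
  exact and_congr_right' ⟨fun h l hl x hx y hy => h ⟨l, hl⟩ ⟨x, hx⟩ ⟨y, hy⟩,
    fun h l x y => h l l.2 x x.2 y y.2⟩

theorem window_three_mul_add_congr {n m n' m' : ℕ} (h : window n m = window n' m') {i j : ℕ}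
    (hi : i < 3) (hj : j < 3) :
    window (3 * n + i) (3 * m + j) = window (3 * n' + i) (3 * m' + j) := by
  rw [window_eq_iff] at h ⊢
  refine ⟨by omega, fun l hl x hx y hy => ?_⟩
  -- As `j + y ≤ 4`, the carry `t` is at most 1, and the recurrences look one column further: hence
  -- three columns in the window.
  obtain ⟨t, s, ht, hs, hts⟩ : ∃ t s, t < 2 ∧ s < 3 ∧ j + y = 3 * t + s :=
    ⟨(j + y) / 3, (j + y) % 3, by omega, by omega, by omega⟩
  rw [show 3 * m + j + y = 3 * (m + t) + s by omega,
    show 3 * m' + j + y = 3 * (m' + t) + s by omega]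
  rcases Nat.lt_or_ge (i + x) 3 with hix | hix
  · rw [add_assoc, add_assoc (3 * n')]
    refine weightDet_three_mul_add_congr h.1 (fun l hl x hx y hy => ?_) hl hix hs
    rw [add_assoc, add_assoc]
    exact h.2 l hl x hx (t + y) (by omega)
  -- Here `i + x = 3`, and only row `n + 1` is needed, not the unavailable row `n + 2`.
  · rw [show 3 * n + i + x = 3 * (n + 1) by omega, show 3 * n' + i + x = 3 * (n' + 1) by omega]
    refine weightDet_three_mul_congr (by omega) (fun l hl y hy => ?_) hl hs
    rw [add_assoc, add_assoc m']
    exact h.2 l hl 1 (by omega) (t + y) (by omega)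

/-- The state of a position of the Hankel determinants of the Cantor sequence. -/
noncomputable def state (N p : ℕ) :
    Fin 2 × Fin 2 × Prop × (Fin 2 × (Fin 2 → Fin 2 → Fin 3 → ZMod 3)) :=
  (⟨N % 2, Nat.mod_lt _ two_pos⟩, ⟨p % 2, Nat.mod_lt _ two_pos⟩, N = 0 ∧ p = 0,
    window (N / 2) (p / 2))

theorem state_eq_iff {N p N' p' : ℕ} : state N p = state N' p' ↔ N % 2 = N' % 2 ∧
    p % 2 = p' % 2 ∧ (N = 0 ∧ p = 0 ↔ N' = 0 ∧ p' = 0) ∧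
    window (N / 2) (p / 2) = window (N' / 2) (p' / 2) := by
  simp only [state, Prod.mk.injEq, Fin.mk.injEq, eq_iff_iff]

theorem state_three_mul_add_congr {N p N' p' : ℕ} (h : state N p = state N' p') {i j : ℕ}
    (hi : i < 3) (hj : j < 3) :
    state (3 * N + i) (3 * p + j) = state (3 * N' + i) (3 * p' + j) := by
  rw [state_eq_iff] at h ⊢
  obtain ⟨h1, h2, h3, h4⟩ := h
  refine ⟨by omega, by omega, by omega, ?_⟩
  -- `(3 * N + i) / 2 = 3 * (N / 2) + (3 * (N % 2) + i) / 2`, where the last term is at most `5 / 2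
  -- = 2`, so it is again a ternary digit.
  have := window_three_mul_add_congr h4 (i := (3 * (N % 2) + i) / 2)
    (j := (3 * (p % 2) + j) / 2) (by omega) (by omega)
  convert this using 2 <;> omega

/-! ### Separation of even and odd indices -/

/-- The two interleaved sets of indices of a Hankel matrix. -/
noncomputable def parityEquiv {n₀ n₁ N : ℕ} (h₀ : n₀ = (N + 1) / 2) (h₁ : n₁ = N / 2) :
    Fin n₀ ⊕ Fin n₁ ≃ Fin N :=
  Equiv.ofBijective (Sum.elim (fun i => ⟨2 * i, by omega⟩) fun i => ⟨2 * i + 1, by omega⟩) <| by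
    refine (Fintype.bijective_iff_injective_and_card _).2 ⟨?_, by simp; omega⟩
    rintro (⟨i, hi⟩ | ⟨i, hi⟩) (⟨j, hj⟩ | ⟨j, hj⟩) hij <;> simp at hij ⊢ <;> omega

/-- If `u` vanishes at the odd places, separating the even from the odd indices expresses its
Hankel determinants through those of `k ↦ u (2 * k)`. -/
theorem det_hankel_of_odd_eq_zero {u : ℕ → ℤ} {l : ℕ} (hodd : ∀ k, u (2 * k + 1) = 0)
    (heven : ∀ k, (u (2 * k) : ZMod 3) = moment ((X + 1) ^ l * X ^ k)) (N p : ℕ) :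
    (((hankel u p N).det : ℤ) : ZMod 3) =
      if p % 2 = 0 then weightDet l (N / 2 + N % 2) (p / 2) * weightDet l (N / 2) (p / 2 + 1)
      else if N % 2 = 0 then (-1) ^ (N / 2) * weightDet l (N / 2) (p / 2 + 1) ^ 2 else 0 := by
  have hmap : (((hankel u p N).det : ℤ) : ZMod 3) =
      (Matrix.of fun i j : Fin N => (u (p + i + j) : ZMod 3)).det :=
    ((Int.castRingHom (ZMod 3)).map_det _).trans rfl
  have hzero : ∀ k, k % 2 = 1 → u k = 0 := fun k hk => by
    rw [← Nat.div_add_mod k 2, hk, hodd]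
  have heven' : ∀ q k j, q = 2 * (k + j) → (u q : ZMod 3) =
      moment (X ^ k * (X + 1) ^ l * X ^ j) := by
    rintro _ k j rfl
    rw [heven, pow_add]
    exact congrArg moment (by ring)
  rw [hmap]
  let e := parityEquiv (N := N) (n₀ := N / 2 + N % 2) (n₁ := N / 2) (by omega) rfl
  have hl : ∀ i, (e (Sum.inl i) : ℕ) = 2 * i := fun i => rfl
  have hr : ∀ i, (e (Sum.inr i) : ℕ) = 2 * i + 1 := fun i => rfl
  split_ifs with hp hN
  · rw [← Matrix.det_submatrix_equiv_self e, weightDet, weightDet,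
      ← Matrix.det_fromBlocks_zero₂₁ _ 0]
    refine congrArg Matrix.det (Matrix.ext ?_)
    rintro (i | i) (j | j)
    all_goals simp only [Matrix.submatrix_apply, Matrix.of_apply, Matrix.fromBlocks_apply₁₁,
      Matrix.fromBlocks_apply₁₂, Matrix.fromBlocks_apply₂₁, Matrix.fromBlocks_apply₂₂, hl, hr,
      Matrix.zero_apply]
    · exact heven' _ _ _ (by omega)
    · rw [hzero _ (by omega), Int.cast_zero]
    · rw [hzero _ (by omega), Int.cast_zero]
    · exact heven' _ _ _ (by omega)
  -- For odd `p` the nonzero entries pair indices of opposite parity. As `N` is even, both index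
  -- sets can be given the same type `Fin (N / 2)`, as the anti-diagonal block formula requires.
  · let e' := parityEquiv (N := N) (n₀ := N / 2) (n₁ := N / 2) (by omega) rfl
    have hl : ∀ i, (e' (Sum.inl i) : ℕ) = 2 * i := fun i => rfl
    have hr : ∀ i, (e' (Sum.inr i) : ℕ) = 2 * i + 1 := fun i => rfl
    rw [← Matrix.det_submatrix_equiv_self e', weightDet, ← det_fromBlocks_zero_self]
    refine congrArg Matrix.det (Matrix.ext ?_)
    rintro (i | i) (j | j)
    all_goals simp only [Matrix.submatrix_apply, Matrix.of_apply, Matrix.fromBlocks_apply₁₁,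
      Matrix.fromBlocks_apply₁₂, Matrix.fromBlocks_apply₂₁, Matrix.fromBlocks_apply₂₂, hl, hr,
      Matrix.zero_apply]
    · rw [hzero _ (by omega), Int.cast_zero]
    · exact heven' _ _ _ (by omega)
    · exact heven' _ _ _ (by omega)
    · rw [hzero _ (by omega), Int.cast_zero]
  -- For `p` and `N` odd, the rows of even index are supported on the columns of odd index, of which
  -- there is one fewer.
  · refine det_eq_zero_of_rows_supported _ (fun i => e (Sum.inl i))
      (e.injective.comp Sum.inl_injective) (fun i => e (Sum.inr i)) (by simp; omega) ?_
    intro i j hj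
    obtain ⟨j | j, rfl⟩ := e.surjective j
    · rw [Matrix.of_apply, hl, hl, hzero _ (by omega), Int.cast_zero]
    · exact absurd ⟨j, rfl⟩ hj

theorem det_hankel_c (N p : ℕ) : (((hankel c p N).det : ℤ) : ZMod 3) =
    if p % 2 = 0 then weightDet 0 (N / 2 + N % 2) (p / 2) * weightDet 0 (N / 2) (p / 2 + 1)
    else if N % 2 = 0 then (-1) ^ (N / 2) * weightDet 0 (N / 2) (p / 2 + 1) ^ 2 else 0 :=
  det_hankel_of_odd_eq_zero c_two_mul_add_one
    (fun k => by rw [pow_zero, one_mul, moment_X_pow]) N p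

/-- `d (2 * k)` is the moment of `X ^ k + X ^ (k + 1)`, which accounts for the weight `X + 1`. -/
theorem det_hankel_d (N p : ℕ) : (((hankel d p N).det : ℤ) : ZMod 3) =
    if p % 2 = 0 then weightDet 1 (N / 2 + N % 2) (p / 2) * weightDet 1 (N / 2) (p / 2 + 1)
    else if N % 2 = 0 then (-1) ^ (N / 2) * weightDet 1 (N / 2) (p / 2 + 1) ^ 2 else 0 :=
  det_hankel_of_odd_eq_zero
    (fun k => by
      rw [d, show 2 * k + 1 + 2 = 2 * (k + 1) + 1 by ring, c_two_mul_add_one, c_two_mul_add_one,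
        add_zero])
    (fun k => by
      rw [d, pow_one, add_mul, one_mul, ← pow_succ', map_add, moment_X_pow, moment_X_pow,
        Int.cast_add, add_comm, mul_add_one]) N p

theorem det_hankel_congr {u : ℕ → ℤ} {l : ℕ} (hl : l < 2)
    (hu : ∀ N p, (((hankel u p N).det : ℤ) : ZMod 3) =
      if p % 2 = 0 then weightDet l (N / 2 + N % 2) (p / 2) * weightDet l (N / 2) (p / 2 + 1)
      else if N % 2 = 0 then (-1) ^ (N / 2) * weightDet l (N / 2) (p / 2 + 1) ^ 2 else 0)
    {N p N' p' : ℕ} (h : state N p = state N' p') :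
    (((hankel u p N).det : ℤ) : ZMod 3) = (((hankel u p' N').det : ℤ) : ZMod 3) := by
  rw [state_eq_iff, window_eq_iff] at h
  obtain ⟨hN, hp, -, hpar, h⟩ := h
  have h01 := h l hl 0 (by simp) 1 (by simp)
  have h0 := h l hl (N % 2) (Nat.mod_lt _ two_pos) 0 (by simp)
  simp only [add_zero] at h01 h0
  rw [hu, hu, h0, h01, hN, hp, neg_one_pow_eq_of_mod_two hpar]

/-- The empty determinant is `1`, so the convention deviates from it only at `N = p = 0`; for this
reason `state` records that position. -/
theorem gammaDet_cast (N p : ℕ) : (gammaDet N p : ZMod 3) =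
    if N = 0 ∧ p = 0 then 2 else (((hankel c p N).det : ℤ) : ZMod 3) := by
  rcases Nat.eq_zero_or_pos N with rfl | hN
  · by_cases hp : p = 0 <;> simp [gammaDet, hp]
  · rw [gammaDet, if_neg hN.ne', if_neg (by omega)]

theorem deltaDet_eq (N p : ℕ) : deltaDet N p = (hankel d p N).det := by
  rcases Nat.eq_zero_or_pos N with rfl | hN
  · simp [deltaDet]
  · rw [deltaDet, if_neg hN.ne']

end CantorHankel

theorem mainTheorem2 :
    CantorHankel.IsKAutomatic 3 (fun n p : ℕ => ((CantorHankel.gammaDet n p : ℤ) : ZMod 3)) ∧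
      CantorHankel.IsKAutomatic 3 (fun n p : ℕ => ((CantorHankel.deltaDet n p : ℤ) : ZMod 3)) := by
  refine ⟨CantorHankel.isKAutomatic_of_state (by norm_num) CantorHankel.state
      (fun _ _ _ _ h i hi j hj => CantorHankel.state_three_mul_add_congr h hi hj)
      fun n p n' p' h => ?_,
    CantorHankel.isKAutomatic_of_state (by norm_num) CantorHankel.state
      (fun _ _ _ _ h i hi j hj => CantorHankel.state_three_mul_add_congr h hi hj)
      fun n p n' p' h => ?_⟩
  · simp only [CantorHankel.gammaDet_cast, (CantorHankel.state_eq_iff.1 h).2.2.1,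
      CantorHankel.det_hankel_congr (by norm_num) CantorHankel.det_hankel_c h]
  · simp only [CantorHankel.deltaDet_eq,
      CantorHankel.det_hankel_congr (by norm_num) CantorHankel.det_hankel_d h]
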